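/- Let $-\tfrac12<d<\tfrac12$ and $\sigma_\epsilon^2>0$. Let $\{\epsilon_n\}_{n\in\mathbb Z}$ be independent $\mathcal N(0,\sigma_\epsilon^2)$ random variables, and let $\{X_n\}_{n\in\mathbb Z}$ be a Gaussian ARFIMA$(0,d,0)$ process with innovations $\epsilon_n$, that is, a stationary Gaussian process such that $(1-L)^dX_n=\epsilon_n$ for all $n\in\mathbb Z$, where $LX_n=X_{n-1}$ and $$(1-L)^dX_n=\sum_{k=0}^{\infty}(-1)^k\binom dk X_{n-k}$$ with convergence in mean square. Then for every $n\ge1$ the vector $(X_1,\dots,X_n)$ has a Lebesgue density $f_n$ with $f_n\log f_n$ integrable, so that the joint differential entropy $h(X_1,\dots,X_n)=-\int_{\mathbb R^n} f_n(x)\log f_n(x)\,dx$ is well defined, and the differential entropy rate of the process exists and equals $$\lim_{n\to\infty}\frac{h(X_1,\dots,X_n)}{n}=\tfrac12\log\!\left(2\pi e\,\sigma_\epsilon^2\right),$$ independently of $d$ (natural logarithm). -/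

import Mathlib

open MeasureTheory ProbabilityTheory Filter Topology
open scoped ENNReal NNReal

noncomputable section

/-- The coefficient `(-1)^k * binom(d, k)` of `L ^ k` in the binomial expansion
`(1 - L)^d = ∑ k, (-1)^k * binom(d, k) * L ^ k` of the fractional difference operator. -/
def fracDiffCoeff (d : ℝ) (k : ℕ) : ℝ :=
  (-1) ^ k * Ring.choose d k

/-- The `N`-th partial sum of `((1 - L)^d X)_n = ∑ k, (-1)^k * binom(d, k) * X_{n - k}`. -/
def fracDiffPartialSum {Ω : Type*} (d : ℝ) (X : ℤ → Ω → ℝ) (n : ℤ) (N : ℕ) (ω : Ω) : ℝ :=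
  ∑ k ∈ Finset.range N, fracDiffCoeff d k * X (n - (k : ℤ)) ω

/-- `(1 - L)^d X = Y`: for every time `n` the series `∑ k, (-1)^k * binom(d, k) * X_{n - k}`
converges to `Y_n` in mean square. -/
def FracDiffEq {Ω : Type*} [MeasurableSpace Ω] (P : Measure Ω) (d : ℝ)
    (X Y : ℤ → Ω → ℝ) : Prop :=
  ∀ n : ℤ, Tendsto (fun N : ℕ => eLpNorm (fun ω => fracDiffPartialSum d X n N ω - Y n ω) 2 P)
    atTop (𝓝 0)

/-- A (strictly) stationary process: its law is invariant under every time shift. -/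
def IsStationaryProcess {Ω : Type*} [MeasurableSpace Ω] (P : Measure Ω)
    (X : ℤ → Ω → ℝ) : Prop :=
  ∀ m : ℤ, IdentDistrib (fun ω (i : ℤ) => X (i + m) ω) (fun ω (i : ℤ) => X i ω) P P

/-- Gaussian white noise: independent, identically distributed `N(0, v)` variables. -/
structure IsGaussianWhiteNoise {Ω : Type*} [MeasurableSpace Ω] (P : Measure Ω)
    (v : ℝ≥0) (ε : ℤ → Ω → ℝ) : Prop where
  hasLaw : ∀ i, HasLaw (ε i) (gaussianReal 0 v) P
  indep : iIndepFun ε P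

/-- `X` is a (Gaussian) ARFIMA(0,d,0) process with innovations `ε` of variance `v`: a stationary
Gaussian process such that `(1 - L)^d X = ε`. -/
structure IsARFIMAZero {Ω : Type*} [MeasurableSpace Ω] (P : Measure Ω)
    (d : ℝ) (v : ℝ≥0) (X ε : ℤ → Ω → ℝ) : Prop where
  neg_half_lt : -(1 / 2) < d
  lt_half : d < 1 / 2
  gaussian : IsGaussianProcess X P
  stationary : IsStationaryProcess P X
  innovations : IsGaussianWhiteNoise P v ε
  eq : FracDiffEq P d X ε

/-- The random vector `(X_1, ..., X_n)`. -/
def initialBlock {Ω : Type*} (X : ℤ → Ω → ℝ) (n : ℕ) (ω : Ω) : Fin n → ℝ :=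
  fun i => X ((i : ℕ) + 1 : ℤ) ω

/-- The density of a random vector `Y` with respect to Lebesgue measure. -/
def lebesgueDensity {Ω : Type*} [MeasurableSpace Ω] (P : Measure Ω) {n : ℕ}
    (Y : Ω → Fin n → ℝ) (x : Fin n → ℝ) : ℝ :=
  (pdf Y P volume x).toReal

/-- The joint differential entropy `h(Y) = -∫ f log f` in nats, where `f` is the Lebesgue density
of the random vector `Y` (the integrand vanishes where `f = 0`). -/
def differentialEntropy {Ω : Type*} [MeasurableSpace Ω] (P : Measure Ω) {n : ℕ}
    (Y : Ω → Fin n → ℝ) : ℝ :=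
  -∫ x, lebesgueDensity P Y x * Real.log (lebesgueDensity P Y x)

/-- `Y` has a Lebesgue density `f`, and the integral defining `h(Y)` converges absolutely. -/
def HasDifferentialEntropy {Ω : Type*} [MeasurableSpace Ω] (P : Measure Ω) {n : ℕ}
    (Y : Ω → Fin n → ℝ) : Prop :=
  HasPDF Y P volume ∧
    Integrable (fun x => lebesgueDensity P Y x * Real.log (lebesgueDensity P Y x))

/-- The differential entropy rate of `X` exists and equals `h`: each `h(X_1, ..., X_n)`, `n ≥ 1`, is well
defined, and `h(X_1, ..., X_n) / n` tends to `h`. -/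
def HasDifferentialEntropyRate {Ω : Type*} [MeasurableSpace Ω] (P : Measure Ω)
    (X : ℤ → Ω → ℝ) (h : ℝ) : Prop :=
  (∀ n : ℕ, 1 ≤ n → HasDifferentialEntropy P (initialBlock X n)) ∧
    Tendsto (fun n : ℕ => differentialEntropy P (initialBlock X n) / n) atTop (𝓝 h)

end

/-! By the chain rule for Gaussian vectors, h(X_1, …, X_n) is the sum of ½ log(2πe s_k) over k < n,
where s_k is the variance of the error in predicting X_{k+1} linearly from X_1, …, X_k. If s_k → v,
the Cesàro means converge to ½ log(2πe v). In L², after centering, s_k is the squared norm of the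
k-th Gram–Schmidt residual.

Upper bound: the truncated fractional difference of X_{k+1} is a competing prediction error, and its
variance tends to v (`tendsto_norm_gramSchmidt_sq`). Lower bound: ε_{k+1} is orthogonal to the past
of X and has inner product v with X_{k+1}, so Cauchy–Schwarz gives s_k ≥ v
(`le_norm_gramSchmidt_sq`).

That orthogonality is not part of the hypotheses. It comes from inverting (1-L)^d on the
cross-correlation of ε and X, which is square summable by Bessel (`inner_innovation_eq`). -/

open scoped InnerProductSpace

/-! ### Binomial coefficients of (1-L)^d: recursion, inversion, summability -/

theorem fracDiffCoeff_zero_right (d : ℝ) : fracDiffCoeff d 0 = 1 := by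
  simp [fracDiffCoeff]

theorem fracDiffCoeff_succ (d : ℝ) (k : ℕ) :
    ((k : ℝ) + 1) * fracDiffCoeff d (k + 1) = (k - d) * fracDiffCoeff d k := by
  have h : ((k : ℝ) + 1) * Ring.choose d (k + 1) = (d - k) * Ring.choose d k := by
    rw [Ring.choose_eq_smul, Ring.choose_eq_smul, descPochhammer_succ_right,
      Polynomial.smeval_mul, Nat.factorial_succ]
    have hk : (k.factorial : ℝ) ≠ 0 := by positivity
    have hk1 : (k : ℝ) + 1 ≠ 0 := by positivity
    simp only [smul_eq_mul, Polynomial.smeval_sub, Polynomial.smeval_X, Polynomial.smeval_natCast]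
    push_cast
    field_simp
    simp
  unfold fracDiffCoeff
  rw [pow_succ]
  linear_combination (-(-1) ^ k) * h

/-- Chu–Vandermonde for -d + d = 0: formally (1-L)^{-d} (1-L)^d = 1. -/
theorem sum_antidiagonal_fracDiffCoeff_neg_mul (d : ℝ) (n : ℕ) :
    ∑ p ∈ Finset.HasAntidiagonal.antidiagonal n, fracDiffCoeff (-d) p.1 * fracDiffCoeff d p.2 =
      if n = 0 then 1 else 0 := by
  have h := Ring.add_choose_eq n (Commute.all (-d) d)
  rw [neg_add_cancel, Ring.choose_zero_ite] at h
  have : ∑ p ∈ Finset.HasAntidiagonal.antidiagonal n, fracDiffCoeff (-d) p.1 * fracDiffCoeff d p.2 =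
      (-1) ^ n * ∑ p ∈ Finset.HasAntidiagonal.antidiagonal n, Ring.choose (-d) p.1 * Ring.choose d p.2 := by
    rw [Finset.mul_sum]
    refine Finset.sum_congr rfl fun p hp => ?_
    rw [← Finset.HasAntidiagonal.mem_antidiagonal.1 hp, pow_add]
    simp only [fracDiffCoeff]
    ring
  rw [this, ← h]
  split_ifs with hn <;> simp [hn]

/-- Telescoping comparison: a nonnegative sequence dominated by the decrements of a nonnegative
sequence is summable. -/
theorem summable_of_le_sub {f T : ℕ → ℝ} {δ : ℝ} (hδ : 0 < δ) (K : ℕ) (hf : ∀ k, 0 ≤ f k)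
    (hT : ∀ k, 0 ≤ T k) (h : ∀ k, K ≤ k → δ * f k ≤ T k - T (k + 1)) : Summable f := by
  rw [← summable_nat_add_iff K]
  refine summable_of_sum_range_le (c := T K / δ) (fun _ => hf _) fun n => ?_
  rw [le_div_iff₀ hδ, mul_comm, Finset.mul_sum]
  have : ∑ i ∈ Finset.range n, δ * f (i + K) ≤ T K - T (n + K) := by
    calc _ ≤ ∑ i ∈ Finset.range n, (T (i + K) - T (i + 1 + K)) := by
          refine Finset.sum_le_sum fun i _ => ?_
          rw [add_right_comm]
          exact h _ (by omega)
      _ = _ := by rw [Finset.sum_range_sub' (fun i => T (i + K)), zero_add]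
  linarith [hT (n + K)]

theorem summable_fracDiffCoeff_sq {d : ℝ} (h₁ : -(1 / 2) < d) (h₂ : d < 1 / 2) :
    Summable fun k => fracDiffCoeff d k ^ 2 := by
  have hδ : 0 < 1 + 2 * d := by linarith
  obtain ⟨K, hK⟩ := exists_nat_ge (1 / (1 + 2 * d))
  rw [div_le_iff₀ hδ] at hK
  -- The decrement of k c_k² is c_k² (k(1+2d) - d²)/(k+1). Once k(1+2d) ≥ 1, the bounds d² < 1/4 and
  -- 1+2d < 2 make the factor at least (1+2d)/4.
  refine summable_of_le_sub (T := fun k => k * fracDiffCoeff d k ^ 2)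
    (δ := (1 + 2 * d) / 4) (by positivity) K (fun _ => sq_nonneg _) (fun _ => by positivity)
    fun k hk => ?_
  have hk' : 1 ≤ (k : ℝ) * (1 + 2 * d) :=
    hK.trans (mul_le_mul_of_nonneg_right (by exact_mod_cast hk) hδ.le)
  have hk1 : 0 < (k : ℝ) + 1 := by positivity
  have hr : fracDiffCoeff d (k + 1) = (k - d) * fracDiffCoeff d k / (k + 1) := by
    rw [eq_div_iff hk1.ne', mul_comm, fracDiffCoeff_succ]
  have : (k : ℝ) * fracDiffCoeff d k ^ 2 - ((k + 1 : ℕ) : ℝ) * fracDiffCoeff d (k + 1) ^ 2 =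
      fracDiffCoeff d k ^ 2 * ((k * (1 + 2 * d) - d ^ 2) / (k + 1)) := by
    rw [hr]
    push_cast
    field_simp
    ring
  rw [this, mul_comm]
  refine mul_le_mul_of_nonneg_left ?_ (sq_nonneg _)
  rw [le_div_iff₀ hk1]
  nlinarith

theorem summable_abs_fracDiffCoeff {d : ℝ} (hd : 0 ≤ d) (h₂ : d < 1) :
    Summable fun k => |fracDiffCoeff d k| := by
  rcases hd.eq_or_lt with rfl | hd
  · refine summable_of_ne_finset_zero (s := {0}) fun k hk => ?_
    rw [Finset.mem_singleton] at hk
    simp [fracDiffCoeff, Ring.choose_zero_pos ℝ (Nat.pos_of_ne_zero hk)]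
  -- For k ≥ 1 the decrement of k |c_k| is exactly d |c_k|; hence the separate case d = 0.
  refine summable_of_le_sub (T := fun k => k * |fracDiffCoeff d k|) hd 1 (fun _ => abs_nonneg _)
    (fun _ => by positivity) fun k hk => ?_
  have hk' : 1 ≤ (k : ℝ) := by exact_mod_cast hk
  have h := congrArg abs (fracDiffCoeff_succ d k)
  rw [abs_mul, abs_mul, abs_of_pos (by positivity : (0 : ℝ) < k + 1),
    abs_of_pos (by linarith : 0 < k - d)] at h
  push_cast
  linarith

/-! ### Convolutions of square summable sequences -/

theorem summable_mul_of_sq {ι : Type*} {p q : ι → ℝ} (hp : Summable fun i => p i ^ 2)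
    (hq : Summable fun i => q i ^ 2) : Summable fun i => |p i * q i| := by
  refine Summable.of_nonneg_of_le (fun _ => abs_nonneg _) (fun i => ?_) ((hp.add hq).div_const 2)
  rw [abs_mul, ← sq_abs (p i), ← sq_abs (q i)]
  nlinarith [sq_nonneg (|p i| - |q i|)]

theorem tsum_abs_mul_le {ι : Type*} {p q : ι → ℝ} (hp : Summable fun i => p i ^ 2)
    (hq : Summable fun i => q i ^ 2) :
    ∑' i, |p i * q i| ≤ (∑' i, p i ^ 2 + ∑' i, q i ^ 2) / 2 := by
  rw [← hp.tsum_add hq, ← tsum_div_const]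
  refine (summable_mul_of_sq hp hq).tsum_le_tsum (fun i => ?_) ((hp.add hq).div_const 2)
  rw [abs_mul, ← sq_abs (p i), ← sq_abs (q i)]
  nlinarith [sq_nonneg (|p i| - |q i|)]

/-- The triple convolution of one absolutely summable and two square summable sequences
converges absolutely. -/
theorem summable_convolution {a p : ℕ → ℝ} {q : ℤ → ℝ} (ha : Summable fun k => |a k|)
    (hp : Summable fun k => p k ^ 2) (hq : Summable fun k => q k ^ 2) (m : ℤ) :
    Summable fun x : ℕ × ℕ => a x.1 * p x.2 * q (m - x.1 - x.2) := by
  have hinj (i : ℕ) : Function.Injective fun j : ℕ => m - (i : ℤ) - (j : ℤ) := fun j k h => by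
    have : m - (i : ℤ) - (j : ℤ) = m - i - k := h
    omega
  have hq' (i : ℕ) : Summable fun j : ℕ => q (m - i - j) ^ 2 := hq.comp_injective (hinj i)
  refine Summable.of_abs ?_
  rw [summable_prod_of_nonneg fun _ => abs_nonneg _]
  simp only [mul_assoc, abs_mul (a _), tsum_mul_left]
  refine ⟨fun i => (summable_mul_of_sq hp (hq' i)).mul_left _,
    Summable.of_nonneg_of_le (fun i => by positivity) (fun i => ?_)
      (ha.mul_right ((∑' i, p i ^ 2 + ∑' i, q i ^ 2) / 2))⟩
  refine mul_le_mul_of_nonneg_left ((tsum_abs_mul_le hp (hq' i)).trans ?_) (abs_nonneg _)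
  gcongr
  exact tsum_comp_le_tsum_of_inj hq (fun _ => sq_nonneg _) (hinj i)

/-- Inversion of a one-sided convolution equation on square summable sequences. -/
theorem eq_of_convolution_eq_single {b c : ℕ → ℝ} {g : ℤ → ℝ} {v : ℝ}
    (hbc : ∀ n, ∑ p ∈ Finset.HasAntidiagonal.antidiagonal n, b p.1 * c p.2 = if n = 0 then 1 else 0)
    (hs : ∀ m : ℤ, Summable fun x : ℕ × ℕ => b x.1 * c x.2 * g (m - x.1 - x.2))
    (hcg : ∀ m : ℤ, ∑' j : ℕ, c j * g (m - j) = if m = 0 then v else 0) (m : ℤ) :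
    g m = ∑' i : ℕ, b i * if m - i = 0 then v else 0 := by
  -- The double series is summed in two ways: over the second index first, which uses `hcg`, and
  -- then along antidiagonals, where `hbc` leaves only g m.
  have h₁ : ∑' x : ℕ × ℕ, b x.1 * c x.2 * g (m - x.1 - x.2) =
      ∑' i : ℕ, b i * if m - i = 0 then v else 0 := by
    rw [(hs m).tsum_prod]
    simp only [mul_assoc, tsum_mul_left, hcg]
  rw [← h₁, ← Finset.HasAntidiagonal.sigmaAntidiagonalEquivProd.tsum_eq]
  have hs' := Finset.HasAntidiagonal.sigmaAntidiagonalEquivProd.summable_iff.2 (hs m)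
  rw [Summable.tsum_sigma (f := fun x => (fun x : ℕ × ℕ => b x.1 * c x.2 * g (m - x.1 - x.2))
    (Finset.HasAntidiagonal.sigmaAntidiagonalEquivProd x)) hs']
  have (n : ℕ) : ∑' x : Finset.HasAntidiagonal.antidiagonal n, b (x : ℕ × ℕ).1 * c (x : ℕ × ℕ).2 *
      g (m - (x : ℕ × ℕ).1 - (x : ℕ × ℕ).2) = if n = 0 then g m else 0 := by
    rw [Finset.tsum_subtype (Finset.HasAntidiagonal.antidiagonal n)
      (fun x : ℕ × ℕ => b x.1 * c x.2 * g (m - x.1 - x.2))]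
    have : ∀ x ∈ Finset.HasAntidiagonal.antidiagonal n, b x.1 * c x.2 * g (m - x.1 - x.2) =
        b x.1 * c x.2 * g (m - n) := fun x hx => by
      rw [← Finset.HasAntidiagonal.mem_antidiagonal.1 hx, Nat.cast_add, sub_sub]
    rw [Finset.sum_congr rfl this, ← Finset.sum_mul, hbc]
    split_ifs with h <;> simp [h]
  simp only [Finset.HasAntidiagonal.sigmaAntidiagonalEquivProd_apply, this]
  simp

/-! ### Innovations and one-step prediction in a Hilbert space -/

section GramSchmidt

variable {E : Type*} [NormedAddCommGroup E] [InnerProductSpace ℝ E]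

/-- Bessel's inequality in summability form, for an orthogonal family of constant norm. -/
theorem summable_inner_sq {ι : Type*} [DecidableEq ι] {e : ι → E} {v : ℝ} (hv : 0 < v)
    (he : ∀ n m, ⟪e n, e m⟫_ℝ = if n = m then v else 0) (y : E) :
    Summable fun n => ⟪e n, y⟫_ℝ ^ 2 := by
  have hon : Orthonormal ℝ fun n => (√v)⁻¹ • e n := by
    rw [orthonormal_iff_ite]
    intro n m
    rw [inner_smul_left, inner_smul_right, he]
    split_ifs
    · have : √v * √v = v := Real.mul_self_sqrt hv.le
      have h0 : √v ≠ 0 := (Real.sqrt_pos.2 hv).ne'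
      simp only [conj_trivial]
      field_simp
      linarith
    · simp
  refine ((hon.inner_products_summable y).mul_left v).congr fun n => ?_
  rw [inner_smul_left, Real.norm_eq_abs, sq_abs, mul_pow, conj_trivial, inv_pow,
    Real.sq_sqrt hv.le, mul_inv_cancel_left₀ hv.ne']

theorem sub_gramSchmidt_mem_span (f : ℕ → E) (k : ℕ) :
    f k - InnerProductSpace.gramSchmidt ℝ f k ∈
      Submodule.span ℝ (InnerProductSpace.gramSchmidt ℝ f '' Set.Iio k) := by
  have h := sub_eq_of_eq_add' (InnerProductSpace.gramSchmidt_def'' ℝ f k)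
  rw [h]
  exact Submodule.sum_mem _ fun i hi => Submodule.smul_mem _ _
    (Submodule.subset_span (Set.mem_image_of_mem _ (Finset.mem_Iio.1 hi)))

section FracDiff

variable {d v : ℝ} {x e : ℤ → E}

/-- The correlations of a fractional noise with its innovations are one-sided. -/
theorem inner_innovation_eq (h₁ : -(1 / 2) < d) (h₂ : d < 1 / 2) (hv : 0 < v)
    (hx : ∀ n m k, ⟪x (n + k), x (m + k)⟫_ℝ = ⟪x n, x m⟫_ℝ)
    (he : ∀ n m, ⟪e n, e m⟫_ℝ = if n = m then v else 0)
    (hxe : ∀ n : ℤ, Tendsto (fun N => ∑ k ∈ Finset.range N, fracDiffCoeff d k • x (n - k)) atTop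
      (𝓝 (e n))) (n m : ℤ) :
    ⟪e n, x m⟫_ℝ =
      ∑' i : ℕ, fracDiffCoeff (-d) i * if m - n - i = 0 then v else 0 := by
  have hshift (n m : ℤ) : ⟪e n, x m⟫_ℝ = ⟪e 0, x (m - n)⟫_ℝ := by
    refine tendsto_nhds_unique ((hxe n).inner (tendsto_const_nhds (x := x m))) ?_
    refine ((hxe 0).inner (tendsto_const_nhds (x := x (m - n)))).congr fun N => ?_
    rw [sum_inner, sum_inner]
    refine Finset.sum_congr rfl fun k _ => ?_
    rw [inner_smul_left, inner_smul_left, ← hx (0 - k) (m - n) n]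
    ring_nf
  -- By shift invariance ⟪e 0, x m⟫ = ⟪e (-m), x 0⟫, so Bessel applies to the orthogonal family e.
  have hg : Summable fun m : ℤ => ⟪e 0, x m⟫_ℝ ^ 2 := by
    have := (summable_inner_sq hv he (x 0)).comp_injective neg_injective
    refine this.congr fun m => ?_
    rw [Function.comp_apply, hshift, zero_sub, neg_neg]
  have hc := summable_fracDiffCoeff_sq h₁ h₂
  have hb : Summable fun k => fracDiffCoeff (-d) k ^ 2 :=
    summable_fracDiffCoeff_sq (by linarith) (by linarith)
  rw [hshift]
  refine eq_of_convolution_eq_single (g := fun m => ⟪e 0, x m⟫_ℝ)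
    (sum_antidiagonal_fracDiffCoeff_neg_mul d) (fun m => ?_) (fun m => ?_) (m - n)
  -- Of the coefficient sequences for d and -d, the one with nonnegative exponent is absolutely
  -- summable; it takes the ℓ¹ slot.
  · rcases le_total 0 d with hd | hd
    · refine ((summable_convolution (summable_abs_fracDiffCoeff hd (by linarith)) hb hg
        m).comp_injective Prod.swap_injective).congr fun y => ?_
      simp only [Function.comp_apply, Prod.fst_swap, Prod.snd_swap]
      rw [sub_right_comm, mul_comm (fracDiffCoeff d _)]
    · exact summable_convolution (summable_abs_fracDiffCoeff (neg_nonneg.2 hd) (by linarith))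
        hc hg m
  · have hinj : Function.Injective fun j : ℕ => m - (j : ℤ) := fun j k h => by
      have : m - (j : ℤ) = m - k := h
      omega
    have hs := (summable_mul_of_sq hc (hg.comp_injective hinj)).of_abs
    refine tendsto_nhds_unique hs.hasSum.tendsto_sum_nat ?_
    have := (tendsto_const_nhds (x := e 0)).inner (𝕜 := ℝ) (hxe m)
    rw [he] at this
    simp only [inner_sum, inner_smul_right, eq_comm (a := (0 : ℤ))] at this
    exact this

/-- Causality: for m ≤ n only the term i = 0 can contribute to the one-sided series. -/
theorem inner_innovation_past (h₁ : -(1 / 2) < d) (h₂ : d < 1 / 2) (hv : 0 < v)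
    (hx : ∀ n m k, ⟪x (n + k), x (m + k)⟫_ℝ = ⟪x n, x m⟫_ℝ)
    (he : ∀ n m, ⟪e n, e m⟫_ℝ = if n = m then v else 0)
    (hxe : ∀ n : ℤ, Tendsto (fun N => ∑ k ∈ Finset.range N, fracDiffCoeff d k • x (n - k)) atTop
      (𝓝 (e n))) {n m : ℤ} (hmn : m ≤ n) :
    ⟪e n, x m⟫_ℝ = if m = n then v else 0 := by
  rw [inner_innovation_eq h₁ h₂ hv hx he hxe, tsum_eq_single 0]
  · simp [fracDiffCoeff_zero_right, sub_eq_zero]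
  · intro i hi
    rw [if_neg (by omega), mul_zero]

/-- The one-step prediction errors of a fractional noise, as Gram–Schmidt residuals, dominate the
innovation variance. -/
theorem le_norm_gramSchmidt_sq (h₁ : -(1 / 2) < d) (h₂ : d < 1 / 2) (hv : 0 < v)
    (hx : ∀ n m k, ⟪x (n + k), x (m + k)⟫_ℝ = ⟪x n, x m⟫_ℝ)
    (he : ∀ n m, ⟪e n, e m⟫_ℝ = if n = m then v else 0)
    (hxe : ∀ n : ℤ, Tendsto (fun N => ∑ k ∈ Finset.range N, fracDiffCoeff d k • x (n - k)) atTop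
      (𝓝 (e n))) (k : ℕ) :
    v ≤ ‖InnerProductSpace.gramSchmidt ℝ (fun i : ℕ => x (i + 1)) k‖ ^ 2 := by
  set f : ℕ → E := fun i => x (i + 1)
  set u := InnerProductSpace.gramSchmidt ℝ f
  have hpast : ∀ y ∈ Submodule.span ℝ (f '' Set.Iio k), ⟪e (k + 1), y⟫_ℝ = 0 := by
    intro y hy
    induction hy using Submodule.span_induction with
    | mem y hy =>
      obtain ⟨i, hi, rfl⟩ := hy
      rw [Set.mem_Iio] at hi
      rw [inner_innovation_past h₁ h₂ hv hx he hxe (by omega), if_neg (by omega)]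
    | zero => simp
    | add y z _ _ hy hz => rw [inner_add_right, hy, hz, add_zero]
    | smul a y _ hy => rw [inner_smul_right, hy, mul_zero]
  have hmem : f k - u k ∈ Submodule.span ℝ (f '' Set.Iio k) := by
    rw [← InnerProductSpace.span_gramSchmidt_Iio ℝ f k]
    exact sub_gramSchmidt_mem_span f k
  have h0 : ⟪e (k + 1), u k⟫_ℝ = v := by
    have := hpast _ hmem
    rw [inner_sub_right, inner_innovation_past h₁ h₂ hv hx he hxe le_rfl, if_pos rfl] at this
    linarith
  have hcs := real_inner_mul_inner_self_le (e (k + 1)) (u k)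
  rw [h0, he, if_pos rfl, real_inner_self_eq_norm_sq] at hcs
  exact le_of_mul_le_mul_left hcs hv

/-- The residual is orthogonal to the earlier vectors, so by Pythagoras it has least norm in the
coset of their span. -/
theorem norm_gramSchmidt_sq_le (f : ℕ → E) (k : ℕ) {w : E}
    (hw : w ∈ Submodule.span ℝ (f '' Set.Iio k)) :
    ‖InnerProductSpace.gramSchmidt ℝ f k‖ ^ 2 ≤ ‖f k + w‖ ^ 2 := by
  set u := InnerProductSpace.gramSchmidt ℝ f
  have hmem : f k - u k ∈ Submodule.span ℝ (u '' Set.Iio k) := sub_gramSchmidt_mem_span f k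
  rw [← InnerProductSpace.span_gramSchmidt_Iio] at hw
  have horth : ∀ y ∈ Submodule.span ℝ (u '' Set.Iio k), ⟪u k, y⟫_ℝ = 0 := by
    intro y hy
    induction hy using Submodule.span_induction with
    | mem y hy =>
      obtain ⟨i, hi, rfl⟩ := hy
      exact InnerProductSpace.gramSchmidt_orthogonal ℝ f (Set.mem_Iio.1 hi).ne'
    | zero => simp
    | add y z _ _ hy hz => rw [inner_add_right, hy, hz, add_zero]
    | smul a y _ hy => rw [inner_smul_right, hy, mul_zero]
  have h := horth _ (add_mem hmem hw)
  have : f k + w = u k + (f k - u k + w) := by abel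
  rw [this, norm_add_sq_real, h]
  nlinarith [sq_nonneg ‖f k - u k + w‖]

/-- The one-step prediction errors of a fractional noise converge to the innovation variance. -/
theorem tendsto_norm_gramSchmidt_sq (h₁ : -(1 / 2) < d) (h₂ : d < 1 / 2) (hv : 0 < v)
    (hx : ∀ n m k, ⟪x (n + k), x (m + k)⟫_ℝ = ⟪x n, x m⟫_ℝ)
    (he : ∀ n m, ⟪e n, e m⟫_ℝ = if n = m then v else 0)
    (hxe : ∀ n : ℤ, Tendsto (fun N => ∑ k ∈ Finset.range N, fracDiffCoeff d k • x (n - k)) atTop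
      (𝓝 (e n))) :
    Tendsto (fun k => ‖InnerProductSpace.gramSchmidt ℝ (fun i : ℕ => x (i + 1)) k‖ ^ 2) atTop
      (𝓝 v) := by
  have hlim : Tendsto (fun k : ℕ =>
      ‖∑ j ∈ Finset.range (k + 1), fracDiffCoeff d j • x (0 - j)‖ ^ 2) atTop (𝓝 v) := by
    have := (((hxe 0).comp (tendsto_add_atTop_nat 1)).norm).pow 2
    rwa [← real_inner_self_eq_norm_sq, he, if_pos rfl] at this
  refine tendsto_of_tendsto_of_tendsto_of_le_of_le tendsto_const_nhds hlim
    (fun k => le_norm_gramSchmidt_sq h₁ h₂ hv hx he hxe k) fun k => ?_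
  have hshift : ‖∑ j ∈ Finset.range (k + 1), fracDiffCoeff d j • x (0 - j)‖ ^ 2 =
      ‖∑ j ∈ Finset.range (k + 1), fracDiffCoeff d j • x (k + 1 - j)‖ ^ 2 := by
    rw [← real_inner_self_eq_norm_sq, ← real_inner_self_eq_norm_sq]
    simp only [sum_inner, inner_sum, inner_smul_left, inner_smul_right]
    refine Finset.sum_congr rfl fun i _ => congrArg _ (Finset.sum_congr rfl fun j _ => ?_)
    rw [← hx (0 - j) (0 - i) (k + 1)]
    ring_nf
  simp only [hshift]
  rw [Finset.sum_range_succ', fracDiffCoeff_zero_right, one_smul, Nat.cast_zero, sub_zero,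
    add_comm (Finset.sum _ _)]
  refine norm_gramSchmidt_sq_le (fun i : ℕ => x (i + 1)) k (Submodule.sum_mem _ fun j hj => ?_)
  -- Term j + 1 of the sum involves x (k - j), which is the vector of index k - 1 - j because
  -- indexing starts at x 1.
  refine Submodule.smul_mem _ _ (Submodule.subset_span ⟨k - 1 - j, ?_, ?_⟩)
  · rw [Finset.mem_range] at hj
    rw [Set.mem_Iio]
    omega
  · rw [Finset.mem_range] at hj
    simp only
    congr 1
    omega

end FracDiff

end GramSchmidt

/-! ### Differential entropy of Gaussian vectors -/

/-- A product of measures with real densities has the product density. -/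
theorem pi_withDensity_ofReal {ι : Type*} [Fintype ι] {f : ι → ℝ → ℝ} (hf : ∀ i x, 0 ≤ f i x)
    (hfi : ∀ i, Integrable (f i)) :
    Measure.pi (fun i => volume.withDensity fun x => ENNReal.ofReal (f i x)) =
      (volume : Measure (ι → ℝ)).withDensity fun x => ENNReal.ofReal (∏ i, f i (x i)) := by
  have (i : ι) : IsFiniteMeasure (volume.withDensity fun x => ENNReal.ofReal (f i x)) :=
    isFiniteMeasure_withDensity_ofReal (hfi i).2
  refine Measure.pi_eq fun s hs => ?_
  rw [withDensity_apply _ (MeasurableSet.univ_pi hs), volume_pi, Measure.restrict_pi_pi,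
    ← ofReal_integral_eq_lintegral_ofReal
      (Integrable.fintype_prod fun i => (hfi i).restrict)
      (ae_of_all _ fun x => Finset.prod_nonneg fun i _ => hf i _),
    integral_fintype_prod_eq_prod, ENNReal.ofReal_prod_of_nonneg
      (fun i _ => integral_nonneg (hf i))]
  refine Finset.prod_congr rfl fun i _ => ?_
  rw [withDensity_apply _ (hs i), ← ofReal_integral_eq_lintegral_ofReal (hfi i).restrict
    (ae_of_all _ (hf i))]

theorem log_gaussianPDFReal (m : ℝ) {w : ℝ≥0} (hw : w ≠ 0) (x : ℝ) :
    Real.log (gaussianPDFReal m w x) =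
      -(1 / 2 * Real.log (2 * Real.pi * w)) - (x - m) ^ 2 / (2 * w) := by
  have hw' : (0 : ℝ) < w := by positivity
  rw [gaussianPDFReal, Real.log_mul (by positivity) (by positivity), Real.log_inv, Real.log_exp,
    Real.log_sqrt (by positivity)]
  ring

theorem integrable_log_gaussianPDFReal (m : ℝ) {w : ℝ≥0} (hw : w ≠ 0) :
    Integrable (fun x => Real.log (gaussianPDFReal m w x)) (gaussianReal m w) := by
  simp only [log_gaussianPDFReal m hw]
  have h : MemLp (fun x => x - m) 2 (gaussianReal m w) :=
    (memLp_id_gaussianReal 2).sub (memLp_const m)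
  exact (integrable_const _).sub (h.integrable_sq.div_const _)

/-- The differential entropy of a real Gaussian law. -/
theorem integral_log_gaussianPDFReal (m : ℝ) {w : ℝ≥0} (hw : w ≠ 0) :
    ∫ x, Real.log (gaussianPDFReal m w x) ∂(gaussianReal m w) =
      -(1 / 2 * Real.log (2 * Real.pi * Real.exp 1 * w)) := by
  have hw' : (0 : ℝ) < w := by positivity
  simp only [log_gaussianPDFReal m hw]
  have h : MemLp (fun x => x - m) 2 (gaussianReal m w) :=
    (memLp_id_gaussianReal 2).sub (memLp_const m)
  have hvar : ∫ x, (x - m) ^ 2 ∂(gaussianReal m w) = w := by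
    have := variance_fun_id_gaussianReal (μ := m) (v := w)
    rwa [variance_eq_integral (by fun_prop), integral_id_gaussianReal] at this
  rw [integral_sub (integrable_const _) (h.integrable_sq.div_const _), integral_div, hvar,
    integral_const, probReal_univ, one_smul,
    show 2 * Real.pi * Real.exp 1 * (w : ℝ) = 2 * Real.pi * w * Real.exp 1 by ring,
    Real.log_mul (x := 2 * Real.pi * w) (by positivity) (by positivity), Real.log_exp]
  field_simp
  ring

/-- The differential entropy of a Gaussian vector which is the image of a vector of uncorrelated
coordinates under a linear map of determinant one. -/
theorem differentialEntropy_of_uncorrelated {Ω : Type*} [MeasurableSpace Ω] {P : Measure Ω} {n : ℕ}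
    {U : Fin n → Ω → ℝ} {Y : Ω → Fin n → ℝ} {T : Matrix (Fin n) (Fin n) ℝ}
    (hU : HasGaussianLaw (fun ω i => U i ω) P) (hcov : ∀ i j, i ≠ j → cov[U i, U j; P] = 0)
    (hvar : ∀ i, 0 < Var[U i; P]) (hT : T.det = 1)
    (hY : ∀ ω, Y ω = T.mulVec fun i => U i ω) :
    HasDifferentialEntropy P Y ∧ differentialEntropy P Y =
      ∑ i, 1 / 2 * Real.log (2 * Real.pi * Real.exp 1 * Var[U i; P]) := by
  have : IsProbabilityMeasure P := hU.isProbabilityMeasure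
  have hUm : AEMeasurable (fun ω i => U i ω) P := hU.aemeasurable
  set m : Fin n → ℝ := fun i => P[U i] with hm
  set w : Fin n → ℝ≥0 := fun i => Var[U i; P].toNNReal with hw
  have hw0 (i) : w i ≠ 0 := (Real.toNNReal_pos.2 (hvar i)).ne'
  have hwc (i) : (w i : ℝ) = Var[U i; P] := Real.coe_toNNReal _ (hvar i).le
  have hlaw (i) : P.map (U i) = gaussianReal (m i) (w i) := (hU.eval i).map_eq_gaussianReal
  have hTm : MeasurePreserving (fun x : Fin n → ℝ => T.mulVec x) := by
    refine ⟨by fun_prop, ?_⟩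
    have := Real.map_matrix_volume_pi_eq_smul_volume_pi (M := T) (by simp [hT])
    rw [hT, inv_one, abs_one, ENNReal.ofReal_one, one_smul] at this
    exact this
  have hinv (x : Fin n → ℝ) : T⁻¹.mulVec (T.mulVec x) = x := by
    rw [Matrix.mulVec_mulVec, Matrix.nonsing_inv_mul _ (by simp [hT]), Matrix.one_mulVec]
  set F : (Fin n → ℝ) → ℝ := fun x => ∏ i, gaussianPDFReal (m i) (w i) (x i) with hF
  have hFm : Measurable F := by
    refine Finset.measurable_prod _ fun i _ => ?_
    exact (measurable_gaussianPDFReal _ _).comp (measurable_pi_apply i)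
  -- Since T has determinant one it preserves volume, so the density of Y is that of U composed with
  -- T⁻¹, with no Jacobian factor.
  set G : (Fin n → ℝ) → ℝ := fun x => F (T⁻¹.mulVec x) with hG
  have hGm : Measurable G := hFm.comp (by fun_prop)
  have hYm : AEMeasurable Y P := by
    rw [show Y = fun ω => T.mulVec fun i => U i ω from funext hY]
    exact hTm.measurable.comp_aemeasurable hUm
  have hmapU : P.map (fun ω i => U i ω) = volume.withDensity fun x => ENNReal.ofReal (F x) := by
    rw [(iIndepFun_iff_map_fun_eq_pi_map fun i => (hU.eval i).aemeasurable).1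
      (hU.iIndepFun_of_covariance_eq_zero hcov), hF,
      ← pi_withDensity_ofReal (fun i => gaussianPDFReal_nonneg _ _)
        fun i => integrable_gaussianPDFReal _ _]
    congr 1
    funext i
    rw [hlaw, gaussianReal_of_var_ne_zero _ (hw0 i)]
    rfl
  have hmapY : P.map Y = volume.withDensity fun x => ENNReal.ofReal (G x) := by
    rw [show Y = (fun x => T.mulVec x) ∘ fun ω i => U i ω from funext hY,
      ← AEMeasurable.map_map_of_aemeasurable hTm.measurable.aemeasurable hUm, hmapU]
    ext s hs
    rw [Measure.map_apply hTm.measurable hs, withDensity_apply _ (hTm.measurable hs),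
      withDensity_apply _ hs, ← hTm.setLIntegral_comp_preimage hs hGm.ennreal_ofReal]
    simp only [hG, hinv]
  have hpdf : HasPDF Y P volume :=
    hasPDF_of_map_eq_withDensity hYm _ hGm.ennreal_ofReal.aemeasurable hmapY
  have hae := (pdf.eq_of_map_eq_withDensity (X := Y) _
    hGm.ennreal_ofReal.aemeasurable).1 hmapY
  have hG0 (x) : 0 ≤ G x := Finset.prod_nonneg fun i _ => gaussianPDFReal_nonneg _ _ _
  have hlog : (fun x => lebesgueDensity P Y x * Real.log (lebesgueDensity P Y x)) =ᵐ[volume]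
      fun x => (pdf Y P volume x).toReal • Real.log (G x) := by
    filter_upwards [hae] with x hx
    rw [lebesgueDensity, smul_eq_mul, hx, ENNReal.toReal_ofReal (hG0 x)]
  -- The entropy is -E[log G(Y)], and along Y the logarithm splits into one-dimensional Gaussian
  -- terms.
  have hGY (ω) : Real.log (G (Y ω)) =
      ∑ i, Real.log (gaussianPDFReal (m i) (w i) (U i ω)) := by
    simp only [hG, hY, hinv, hF]
    exact Real.log_prod fun i _ => (gaussianPDFReal_pos _ _ _ (hw0 i)).ne'
  have hint (i) : Integrable (fun ω => Real.log (gaussianPDFReal (m i) (w i) (U i ω))) P := by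
    have := integrable_log_gaussianPDFReal (m i) (hw0 i)
    rw [← hlaw] at this
    exact this.comp_aemeasurable (hU.eval i).aemeasurable
  have hval (i) : ∫ ω, Real.log (gaussianPDFReal (m i) (w i) (U i ω)) ∂P =
      -(1 / 2 * Real.log (2 * Real.pi * Real.exp 1 * Var[U i; P])) := by
    have := integral_log_gaussianPDFReal (m i) (hw0 i)
    rwa [← hlaw, integral_map (hU.eval i).aemeasurable
      (measurable_gaussianPDFReal _ _).log.aestronglyMeasurable, hwc] at this
  have hlogm : AEStronglyMeasurable (fun x => Real.log (G x)) volume :=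
    hGm.log.aestronglyMeasurable
  refine ⟨⟨hpdf, ?_⟩, ?_⟩
  · rw [integrable_congr hlog, pdf.integrable_pdf_smul_iff hlogm]
    simp only [hGY]
    exact integrable_finsetSum _ fun i _ => hint i
  · rw [differentialEntropy, integral_congr_ae hlog, pdf.integral_pdf_smul hlogm]
    simp only [hGY]
    rw [integral_finsetSum _ fun i _ => hint i, ← Finset.sum_neg_distrib]
    simp only [hval, neg_neg]

/-- Gram–Schmidt orthogonalization as a unitriangular change of coordinates. -/
theorem exists_det_eq_one_gramSchmidt {E : Type*} [NormedAddCommGroup E] [InnerProductSpace ℝ E]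
    (f : ℕ → E) (n : ℕ) : ∃ T : Matrix (Fin n) (Fin n) ℝ, T.det = 1 ∧
      ∀ i : Fin n, ∑ j, T⁻¹ i j • f j = InnerProductSpace.gramSchmidt ℝ f i := by
  set u := InnerProductSpace.gramSchmidt ℝ f with hu
  set T : Matrix (Fin n) (Fin n) ℝ := fun i j =>
    if j < i then ⟪u j, f i⟫_ℝ / ‖u j‖ ^ 2 else if j = i then 1 else 0 with hT
  have hdet : T.det = 1 := by
    rw [Matrix.det_of_isLowerTriangular T fun i j hij => ?_]
    · simp [hT]
    · have hij' : i < j := hij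
      simp [hT, hij'.not_gt, hij'.ne']
  have hTf (i : Fin n) : ∑ j, T i j • u j = f i := by
    have h := InnerProductSpace.gramSchmidt_def'' ℝ f (i : ℕ)
    rw [← hu] at h
    rw [h]
    have hsplit (j : Fin n) : T i j • u j = (if j = i then u i else 0) +
        if (j : ℕ) < i then (⟪u j, f i⟫_ℝ / ‖u j‖ ^ 2) • u j else 0 := by
      simp only [hT]
      rcases lt_trichotomy j i with hj | rfl | hj
      · simp [hj, hj.ne]
      · simp
      · simp [hj.not_gt, hj.ne']
    rw [Finset.sum_congr rfl fun j _ => hsplit j, Finset.sum_add_distrib, Finset.sum_ite_eq',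
      if_pos (Finset.mem_univ _),
      Fin.sum_univ_eq_sum_range
        (fun j => if j < (i : ℕ) then (⟪u j, f i⟫_ℝ / ‖u j‖ ^ 2) • u j else 0) n,
      ← Finset.sum_filter]
    congr 1
    refine Finset.sum_congr ?_ fun _ _ => rfl
    ext j
    simp only [Finset.mem_filter, Finset.mem_range, Finset.mem_Iio]
    omega
  refine ⟨T, hdet, fun i => ?_⟩
  simp only [← hTf, Finset.smul_sum, smul_smul]
  rw [Finset.sum_comm]
  simp only [← Finset.sum_smul, ← Matrix.mul_apply]
  rw [Matrix.nonsing_inv_mul T (by simp [hdet])]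
  simp [Matrix.one_apply]

/-! ### From random variables to centered vectors of L² -/

theorem inner_toLp {Ω : Type*} [MeasurableSpace Ω] {P : Measure Ω} {Y Z : Ω → ℝ}
    (hY : MemLp Y 2 P) (hZ : MemLp Z 2 P) :
    ⟪hY.toLp Y, hZ.toLp Z⟫_ℝ = ∫ ω, Y ω * Z ω ∂P := by
  rw [L2.inner_def]
  refine integral_congr_ae ?_
  filter_upwards [hY.coeFn_toLp, hZ.coeFn_toLp] with ω h₁ h₂
  rw [h₁, h₂, real_inner_eq_re_inner]
  simp [mul_comm]

section Centering

variable {Ω : Type*} [MeasurableSpace Ω] (P : Measure Ω) [IsProbabilityMeasure P]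

/-- Subtraction of the mean, as an operator on square integrable random variables. -/
noncomputable def centering : Lp ℝ 2 P →L[ℝ] Lp ℝ 2 P :=
  ContinuousLinearMap.id ℝ _ -
    (innerSL ℝ ((memLp_const (1 : ℝ)).toLp (fun _ => (1 : ℝ)) : Lp ℝ 2 P)).smulRight
      ((memLp_const (1 : ℝ)).toLp (fun _ => (1 : ℝ)))

variable {P}

/-- X is not assumed to have mean zero; centering makes covariance an inner product and, being
continuous and linear, respects the mean-square series. -/
theorem inner_centering_toLp {Y Z : Ω → ℝ} (hY : MemLp Y 2 P) (hZ : MemLp Z 2 P) :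
    ⟪centering P (hY.toLp Y), centering P (hZ.toLp Z)⟫_ℝ = cov[Y, Z; P] := by
  rw [covariance_eq_sub hY hZ]
  simp only [centering, sub_apply, ContinuousLinearMap.id_apply,
    ContinuousLinearMap.smulRight_apply, innerSL_apply_apply, inner_sub_left, inner_sub_right,
    inner_smul_left, inner_smul_right, inner_toLp, conj_trivial]
  simp

end Centering

theorem IsStationaryProcess.covariance_add {Ω : Type*} [MeasurableSpace Ω] {P : Measure Ω}
    [IsProbabilityMeasure P] {X : ℤ → Ω → ℝ} (hX : IsStationaryProcess P X)
    (hL : ∀ n, MemLp (X n) 2 P) (n m k : ℤ) :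
    cov[X (n + k), X (m + k); P] = cov[X n, X m; P] := by
  rw [covariance_eq_sub (hL _) (hL _), covariance_eq_sub (hL _) (hL _)]
  have h₁ (i : ℤ) : P[X (i + k)] = P[X i] :=
    ((hX k).comp (u := fun x : ℤ → ℝ => x i) (measurable_pi_apply i)).integral_eq
  have h₂ : P[X (n + k) * X (m + k)] = P[X n * X m] :=
    ((hX k).comp (u := fun x : ℤ → ℝ => x n * x m)
      ((measurable_pi_apply n).mul (measurable_pi_apply m))).integral_eq
  rw [h₁, h₁, h₂]

theorem IsGaussianWhiteNoise.covariance_eq {Ω : Type*} [MeasurableSpace Ω] {P : Measure Ω}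
    [IsProbabilityMeasure P] {v : ℝ≥0} {ε : ℤ → Ω → ℝ} (hε : IsGaussianWhiteNoise P v ε)
    (hL : ∀ n, MemLp (ε n) 2 P) (n m : ℤ) :
    cov[ε n, ε m; P] = if n = m then (v : ℝ) else 0 := by
  split_ifs with h
  · rw [h, covariance_self (hε.hasLaw m).aemeasurable, (hε.hasLaw m).variance_eq]
    exact variance_id_gaussianReal
  · exact (hε.indep.indepFun h).covariance_eq_zero (hL n) (hL m)

theorem ProbabilityTheory.IsGaussianProcess.hasGaussianLaw_initialBlock {Ω : Type*} [MeasurableSpace Ω]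
    {P : Measure Ω} {X : ℤ → Ω → ℝ} (hX : IsGaussianProcess X P) (n : ℕ) :
    HasGaussianLaw (initialBlock X n) P := by
  set I : Finset ℤ := Finset.univ.image fun i : Fin n => ((i : ℕ) : ℤ) + 1 with hI
  exact (hX.hasGaussianLaw I).map_fun (ContinuousLinearMap.pi fun i : Fin n =>
    ContinuousLinearMap.proj (R := ℝ) (φ := fun _ : I => ℝ)
      ⟨((i : ℕ) : ℤ) + 1, Finset.mem_image_of_mem _ (Finset.mem_univ i)⟩)

/-- The joint differential entropy of a Gaussian block is the sum of the differential entropies of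
its Gram–Schmidt residuals. -/
theorem differentialEntropy_initialBlock {Ω : Type*} [MeasurableSpace Ω] {P : Measure Ω}
    [IsProbabilityMeasure P] {X : ℤ → Ω → ℝ} (hX : IsGaussianProcess X P)
    (hL : ∀ n, MemLp (X n) 2 P)
    (hpos : ∀ k, 0 < ‖InnerProductSpace.gramSchmidt ℝ
      (fun i : ℕ => centering P ((hL (i + 1)).toLp (X (i + 1)))) k‖ ^ 2) (n : ℕ) :
    HasDifferentialEntropy P (initialBlock X n) ∧ differentialEntropy P (initialBlock X n) =
      ∑ k ∈ Finset.range n, 1 / 2 * Real.log (2 * Real.pi * Real.exp 1 *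
        ‖InnerProductSpace.gramSchmidt ℝ
          (fun i : ℕ => centering P ((hL (i + 1)).toLp (X (i + 1)))) k‖ ^ 2) := by
  set f : ℕ → Lp ℝ 2 P := fun i : ℕ => centering P ((hL (i + 1)).toLp (X (i + 1))) with hf
  set u := InnerProductSpace.gramSchmidt ℝ f with hu
  obtain ⟨T, hdet, hTu⟩ := exists_det_eq_one_gramSchmidt f n
  -- These are the Gram–Schmidt residuals with the means left in, which affects neither covariances
  -- nor entropy.
  set U : Fin n → Ω → ℝ := fun i ω => ∑ j, T⁻¹ i j * X ((j : ℕ) + 1 : ℤ) ω with hU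
  have hUT (ω) : (fun i => U i ω) = T⁻¹.mulVec (initialBlock X n ω) := rfl
  have hUlaw : HasGaussianLaw (fun ω i => U i ω) P :=
    (hX.hasGaussianLaw_initialBlock n).map_fun (Matrix.toLin' T⁻¹).toContinuousLinearMap
  have hLj (i j : Fin n) : MemLp (fun ω => T⁻¹ i j * X ((j : ℕ) + 1 : ℤ) ω) 2 P :=
    (hL _).const_mul _
  have hcov (i k : Fin n) : cov[U i, U k; P] = ⟪u i, u k⟫_ℝ := by
    rw [hu, ← hTu i, ← hTu k, covariance_fun_sum_fun_sum (hLj i) (hLj k)]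
    simp only [sum_inner, inner_sum, inner_smul_left, inner_smul_right, conj_trivial,
      covariance_const_mul_left, covariance_const_mul_right, hf, inner_centering_toLp]
    rw [Finset.sum_comm]
    refine Finset.sum_congr rfl fun a _ => ?_
    rw [Finset.mul_sum]
  have hvar (i : Fin n) : Var[U i; P] = ‖u i‖ ^ 2 := by
    rw [← covariance_self (hUlaw.eval i).aemeasurable, hcov, real_inner_self_eq_norm_sq]
  have h := differentialEntropy_of_uncorrelated (T := T) (Y := initialBlock X n) hUlaw
    (fun i j hij => ?_) (fun i => ?_) hdet fun ω => ?_
  · refine ⟨h.1, h.2.trans ?_⟩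
    simp only [hvar]
    exact Fin.sum_univ_eq_sum_range
      (fun k => 1 / 2 * Real.log (2 * Real.pi * Real.exp 1 * ‖u k‖ ^ 2)) n
  · rw [hcov]
    exact InnerProductSpace.gramSchmidt_orthogonal ℝ f (Fin.val_ne_of_ne hij)
  · rw [hvar]
    exact hpos i
  · rw [hUT, Matrix.mulVec_mulVec, Matrix.mul_nonsing_inv T (by simp [hdet]), Matrix.one_mulVec]

theorem mainTheorem5 {Ω : Type*} [MeasurableSpace Ω] (P : Measure Ω) [IsProbabilityMeasure P]
    (d : ℝ) (v : ℝ≥0) (hv : 0 < v) (X ε : ℤ → Ω → ℝ) (hX : IsARFIMAZero P d v X ε) :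
    HasDifferentialEntropyRate P X (1 / 2 * Real.log (2 * Real.pi * Real.exp 1 * (v : ℝ))) := by
  have hv' : (0 : ℝ) < v := hv
  have hLX (n) : MemLp (X n) 2 P := (hX.gaussian.hasGaussianLaw_eval n).memLp_two
  have hLε (n) : MemLp (ε n) 2 P := (hX.innovations.hasLaw n).hasGaussianLaw.memLp_two
  set x : ℤ → Lp ℝ 2 P := fun n => centering P ((hLX n).toLp (X n)) with hx
  set e : ℤ → Lp ℝ 2 P := fun n => centering P ((hLε n).toLp (ε n)) with he
  have hxx (n m k : ℤ) : ⟪x (n + k), x (m + k)⟫_ℝ = ⟪x n, x m⟫_ℝ := by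
    simp only [hx, inner_centering_toLp, hX.stationary.covariance_add hLX]
  have hee (n m : ℤ) : ⟪e n, e m⟫_ℝ = if n = m then (v : ℝ) else 0 := by
    simp only [he, inner_centering_toLp, hX.innovations.covariance_eq hLε]
  have hxe (n : ℤ) : Tendsto
      (fun N => ∑ k ∈ Finset.range N, fracDiffCoeff d k • x (n - k)) atTop (𝓝 (e n)) := by
    have hS (N : ℕ) : MemLp (fracDiffPartialSum d X n N) 2 P :=
      memLp_finsetSum _ fun k _ => (hLX _).const_mul _
    have h := (Lp.tendsto_Lp_iff_tendsto_eLpNorm'' (fun N => fracDiffPartialSum d X n N) hS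
      (ε n) (hLε n)).2 (hX.eq n)
    refine (((centering P).continuous.tendsto _).comp h).congr fun N => ?_
    have hsum : (hS N).toLp (fracDiffPartialSum d X n N) =
        ∑ k ∈ Finset.range N, fracDiffCoeff d k • (hLX (n - k)).toLp (X (n - k)) := by
      induction N with
      | zero =>
        rw [Finset.sum_range_zero, ← MemLp.toLp_zero (MemLp.zero' (p := 2) (μ := P))]
        rfl
      | succ N ih =>
        rw [Finset.sum_range_succ, ← ih, ← MemLp.toLp_const_smul, ← MemLp.toLp_add]
        congr 1
        funext ω
        simp [fracDiffPartialSum, Finset.sum_range_succ]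
    simp only [Function.comp_apply, hsum, map_sum, map_smul, hx]
  have hge := le_norm_gramSchmidt_sq hX.neg_half_lt hX.lt_half hv' hxx hee hxe
  have hlim := tendsto_norm_gramSchmidt_sq hX.neg_half_lt hX.lt_half hv' hxx hee hxe
  have hent := differentialEntropy_initialBlock hX.gaussian hLX fun k => hv'.trans_le (hge k)
  refine ⟨fun n _ => (hent n).1, ?_⟩
  have hlog := (((hlim.const_mul (2 * Real.pi * Real.exp 1)).log (by positivity)).const_mul
    (1 / 2)).cesaro
  refine hlog.congr fun n => ?_
  rw [(hent n).2]
  exact (div_eq_inv_mul _ _).symm
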